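/- **Proposition 2 (Mean Intensity).** Let $\phi^{?,s},\phi^{?,c}$, $?\in\{T,F,I,N\}$, be eight nonnegative integrable functions on $\mathbb R$ that vanish on $(-\infty,0)$, let $$\Phi^?_t=\begin{pmatrix}\phi^{?,s}_t&\phi^{?,c}_t\\ \phi^{?,c}_t&\phi^{?,s}_t\end{pmatrix},\qquad \Phi_t=\begin{pmatrix}\Phi^T_t&\Phi^F_t\\ \Phi^I_t&\Phi^N_t\end{pmatrix},\qquad M=(\mu,\mu,0,0)^{\top},\quad \mu\ge 0,$$ and write $\hat F_z=\int_{\mathbb R}e^{-izt}F_t\,dt$ entrywise. Let $P=(T^-,T^+,N^-,N^+)$ be a Hawkes process on $\mathbb R$ with exogenous intensity $M$ and kernel $\Phi$, that is, a four-dimensional counting process (unit jumps, no simultaneous jumps) whose conditional intensity with respect to its own history is $$\lambda_t=M+\int_{\mathbb R}\Phi_{t-s}\,dP_s .$$ Suppose that $P$ has stationary increments and that its mean intensity $E(\lambda_0)$ is finite. Assume (H): all (complex) eigenvalues of the matrix $\hat\Phi_0$ have modulus strictly smaller than $1$. Then $I-\hat\Phi_0$ is invertible, $\Lambda=E(\lambda_t)$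 is finite, does not depend on $t\in\mathbb R$ and has the form $\Lambda=(\Lambda^T,\Lambda^T,\Lambda^N,\Lambda^N)^{\top}$, and $$\Lambda=(I-\hat\Phi_0)^{-1}M .$$ Explicitly, with $v=(1,1)^{\top}$, $$\begin{pmatrix}\Lambda^T\\ \Lambda^T\end{pmatrix}=\mu(I+\hat D_0)(I-\hat\Phi^N_0)v,\qquad \begin{pmatrix}\Lambda^N\\ \Lambda^N\end{pmatrix}=\mu(I+\hat D_0)\hat\Phi^I_0v,$$ where $$\hat D_z=\big((I-\hat\Phi^T_z)(I-\hat\Phi^N_z)-\hat\Phi^F_z\hat\Phi^I_z\big)^{-1}-I,$$ the inverse existing for all $z\in\mathbb C$ with $\operatorname{Im}z\le 0$. -/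

import Mathlib

open MeasureTheory ProbabilityTheory
open scoped ENNReal NNReal Matrix

noncomputable section

namespace HawkesPrice

/-! ### Point processes on the real line and their conditional intensity

A counting process `(P_t)` indexed by the real line is represented by its random jump measure `dP`,
so that `P_b - P_a = dP (a, b]`. -/

section PointProcess

variable {Ω : Type*} [MeasurableSpace Ω] {ι : Type*}

/-- A multivariate counting process: random measures on the line that give a finite integer mass to
every bounded interval, have jumps of size one only, and never jump simultaneously. -/
structure IsCountingProcess [Fintype ι] (dP : ι → Ω → Measure ℝ) : Prop where
  measurable : ∀ i, Measurable (dP i)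
  integer : ∀ i ω a b, ∃ n : ℕ, dP i ω (Set.Ioc a b) = n
  simple : ∀ ω t, ∑ i, dP i ω {t} ≤ 1

/-- The internal history at time `t`: generated by all increments `P_b - P_a`, `b ≤ t`,
of all components. -/
@[reducible]
def history (dP : ι → Ω → Measure ℝ) (t : ℝ) : MeasurableSpace Ω :=
  ⨆ (i : ι) (a : ℝ) (b : ℝ) (_ : b ≤ t),
    MeasurableSpace.comap (fun ω => dP i ω (Set.Ioc a b)) inferInstance

/-- `lam` is a conditional intensity of the counting process with respect to its internal history
`H`: it is jointly measurable, adapted, locally integrable along almost every path, and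
`E[P_b - P_a | H_a] = E[∫_a^b lam_u du | H_a]`, which is written here through the integrals over the
events of `H_a`. -/
structure IsConditionalIntensity (prob : Measure Ω) (dP : ι → Ω → Measure ℝ)
    (lam : ι → ℝ → Ω → ℝ≥0∞) : Prop where
  measurable : ∀ i, Measurable (fun p : ℝ × Ω => lam i p.1 p.2)
  adapted : ∀ i t, Measurable[history dP t] (lam i t)
  locallyIntegrable : ∀ i a b, ∀ᵐ ω ∂prob, ∫⁻ u in Set.Ioc a b, lam i u ω < ∞
  compensator : ∀ i a b (A : Set Ω), MeasurableSet[history dP a] A →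
    ∫⁻ ω in A, dP i ω (Set.Ioc a b) ∂prob =
      ∫⁻ ω in A, (∫⁻ u in Set.Ioc a b, lam i u ω) ∂prob

/-- Stationary increments: the joint law of the jump measures is invariant under time shifts. -/
def HasStationaryIncrements (prob : Measure Ω) (dP : ι → Ω → Measure ℝ) : Prop :=
  ∀ h : ℝ, IdentDistrib (fun ω i => (dP i ω).map (fun s => s + h)) (fun ω i => dP i ω) prob prob

/-- The process `lam_t = M + Φ ⋆ dP_t`, that is
`lam^i_t = M_i + ∑_j ∫ Φ^{ij}_{t-s} dP^j_s`, for nonnegative `M` and `Φ`. -/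
def hawkesIntensity [Fintype ι] (M : ι → ℝ) (Φ : ℝ → Matrix ι ι ℝ) (dP : ι → Ω → Measure ℝ)
    (i : ι) (t : ℝ) (ω : Ω) : ℝ≥0∞ :=
  ENNReal.ofReal (M i) + ∑ j, ∫⁻ s, ENNReal.ofReal (Φ (t - s) i j) ∂(dP j ω)

/-- A Hawkes process with exogenous intensity `M` and kernel `Φ`. -/
structure IsHawkesProcess [Fintype ι] (prob : Measure Ω) (M : ι → ℝ) (Φ : ℝ → Matrix ι ι ℝ)
    (dP : ι → Ω → Measure ℝ) : Prop where
  counting : IsCountingProcess dP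
  intensity : IsConditionalIntensity prob dP (hawkesIntensity M Φ dP)

end PointProcess

/-! ### The kernels of the model -/

/-- A kernel function: measurable, integrable, nonnegative and causal. -/
structure IsKernelFunction (f : ℝ → ℝ) : Prop where
  measurable : Measurable f
  integrable : Integrable f
  nonneg : ∀ t, 0 ≤ f t
  causal : ∀ t, t < 0 → f t = 0

/-- The eight kernel functions `φ^{?,s}` (self) and `φ^{?,c}` (cross), `? = T, F, I, N`. -/
structure Kernels where
  Ts : ℝ → ℝ
  Tc : ℝ → ℝ
  Fs : ℝ → ℝ
  Fc : ℝ → ℝ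
  Is : ℝ → ℝ
  Ic : ℝ → ℝ
  Ns : ℝ → ℝ
  Nc : ℝ → ℝ

/-- All eight functions are kernel functions. -/
structure Kernels.Admissible (φ : Kernels) : Prop where
  Ts : IsKernelFunction φ.Ts
  Tc : IsKernelFunction φ.Tc
  Fs : IsKernelFunction φ.Fs
  Fc : IsKernelFunction φ.Fc
  Is : IsKernelFunction φ.Is
  Ic : IsKernelFunction φ.Ic
  Ns : IsKernelFunction φ.Ns
  Nc : IsKernelFunction φ.Nc

/-- The four components: `Sum.inl 0, Sum.inl 1` are the trades `T⁻, T⁺`, and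
`Sum.inr 0, Sum.inr 1` are the price jumps `N⁻, N⁺`. -/
abbrev Comp := Fin 2 ⊕ Fin 2

/-- The `2 × 2` symmetric block with self term `s` and cross term `c`. -/
def block (s c : ℝ → ℝ) (t : ℝ) : Matrix (Fin 2) (Fin 2) ℝ := !![s t, c t; c t, s t]

namespace Kernels

variable (φ : Kernels)

def ΦT : ℝ → Matrix (Fin 2) (Fin 2) ℝ := block φ.Ts φ.Tc
def ΦF : ℝ → Matrix (Fin 2) (Fin 2) ℝ := block φ.Fs φ.Fc
def ΦI : ℝ → Matrix (Fin 2) (Fin 2) ℝ := block φ.Is φ.Ic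
def ΦN : ℝ → Matrix (Fin 2) (Fin 2) ℝ := block φ.Ns φ.Nc

/-- The `4 × 4` kernel. -/
def Φ (t : ℝ) : Matrix Comp Comp ℝ :=
  Matrix.fromBlocks (φ.ΦT t) (φ.ΦF t) (φ.ΦI t) (φ.ΦN t)

end Kernels

/-- The exogenous intensity `(μ, μ, 0, 0)`. -/
def exogenous (μ : ℝ) : Comp → ℝ := Sum.elim (fun _ => μ) (fun _ => 0)

/-- The entrywise Laplace transform `∫ e^{-izt} F_t dt` of a matrix of functions. -/
def lap {m n : Type*} (F : ℝ → Matrix m n ℝ) (z : ℂ) : Matrix m n ℂ :=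
  Matrix.of fun i j => ∫ t : ℝ, Complex.exp (-Complex.I * z * t) * (F t i j : ℂ)

namespace Kernels

variable (φ : Kernels)

/-- Condition (H): all complex eigenvalues of the matrix of the integrals of the kernels have
modulus strictly smaller than one. -/
def ConditionH : Prop := ∀ x ∈ spectrum ℂ (lap φ.Φ 0), ‖x‖ < 1

/-- `(I - Φ̂^T_z) (I - Φ̂^N_z) - Φ̂^F_z Φ̂^I_z`. -/
def schur (z : ℂ) : Matrix (Fin 2) (Fin 2) ℂ :=
  (1 - lap φ.ΦT z) * (1 - lap φ.ΦN z) - lap φ.ΦF z * lap φ.ΦI z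

/-- `D̂_z = ((I - Φ̂^T_z) (I - Φ̂^N_z) - Φ̂^F_z Φ̂^I_z)⁻¹ - I`. -/
def Dhat (z : ℂ) : Matrix (Fin 2) (Fin 2) ℂ := (φ.schur z)⁻¹ - 1

end Kernels

end HawkesPrice

end

noncomputable section

namespace HawkesPrice

/-! ### Stationarity and the balance equation. -/

section MeanIntensity

variable {Ω ι : Type*}

/-! Stationarity makes the mean intensity `c` constant in time. The compensator identity and Tonelli
then show that component `j` has mean jump measure `c j • volume`, so the expectation of `λ = M + Φ
⋆ dP` is the balance equation `c = M + Φ̂₀ c` (`IsHawkesProcess.mean_balance`). As `c` is finite,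
this is a linear system over the reals.

Invertibility of `I - Φ̂_z` on the closed lower half plane comes from domination: if `A v = v` and
`|A| ≤ b` entrywise, then `|v| ≤ b ^ k |v|` for every `k`, while (H) and Gelfand's formula make some
power of `b = Φ̂₀` a strict contraction (`isUnit_one_sub_of_norm_le`). Hence `v = 0`.

The 2 × 2 blocks commute, so the system can be solved by elimination as if its blocks were scalars.
Equality of the two components within each pair follows from uniqueness, because exchanging `-` and
`+` preserves the system. -/

lemma measurable_ofReal_comp_sub {f : ℝ → ℝ} (hf : Measurable f) (t : ℝ) :
    Measurable fun s => ENNReal.ofReal (f (t - s)) := by fun_prop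

/-- The Hawkes intensity at time `t` is the intensity at time `0` of the shifted process. -/
lemma hawkesIntensity_eq_shift [Fintype ι] (M : ι → ℝ) {Φ : ℝ → Matrix ι ι ℝ}
    (hΦ : ∀ i j, Measurable fun t => Φ t i j) (dP : ι → Ω → Measure ℝ) (i : ι) (t : ℝ) (ω : Ω) :
    hawkesIntensity M Φ dP i t ω =
      hawkesIntensity M Φ (fun j ω => (dP j ω).map (fun s => s + -t)) i 0 ω := by
  unfold hawkesIntensity
  congr 1
  refine Finset.sum_congr rfl fun j _ => ?_
  rw [lintegral_map (measurable_ofReal_comp_sub (hΦ i j) 0) (by fun_prop)]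
  simp [sub_eq_add_neg, add_comm]

/-- A Hawkes intensity driven by a process with stationary increments has a constant mean. -/
lemma lintegral_hawkesIntensity_eq_of_stationary [MeasurableSpace Ω] [Fintype ι]
    {prob : Measure Ω} (M : ι → ℝ)
    {Φ : ℝ → Matrix ι ι ℝ} (hΦ : ∀ i j, Measurable fun t => Φ t i j) {dP : ι → Ω → Measure ℝ}
    (hstat : HasStationaryIncrements prob dP) (i : ι) (t : ℝ) :
    ∫⁻ ω, hawkesIntensity M Φ dP i t ω ∂prob = ∫⁻ ω, hawkesIntensity M Φ dP i 0 ω ∂prob := by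
  -- The intensity at time `0` is one fixed measurable functional of the jump measures, so its mean
  -- depends only on their joint law.
  have hu : Measurable fun ν : ι → Measure ℝ =>
      ENNReal.ofReal (M i) + ∑ j, ∫⁻ s, ENNReal.ofReal (Φ (0 - s) i j) ∂(ν j) := by
    refine Measurable.const_add (Finset.measurable_sum _ fun j _ => ?_) _
    exact (Measure.measurable_lintegral (measurable_ofReal_comp_sub (hΦ i j) 0)).comp
      (measurable_pi_apply j)
  simp_rw [hawkesIntensity_eq_shift M hΦ dP i t]
  exact ((hstat (-t)).comp hu).lintegral_eq

/-- If the intensity has constant mean `c`, then the mean measure of the process is `c` times the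
Lebesgue measure. -/
lemma IsConditionalIntensity.bind_eq_smul_volume [MeasurableSpace Ω] {prob : Measure Ω}
    [SFinite prob] {dP : ι → Ω → Measure ℝ} {lam : ι → ℝ → Ω → ℝ≥0∞} (hlam : IsConditionalIntensity prob dP lam)
    (hdP : ∀ i, Measurable (dP i)) {i : ι} {c : ℝ≥0∞} (hc : c ≠ ∞)
    (hmean : ∀ t, ∫⁻ ω, lam i t ω ∂prob = c) :
    prob.bind (dP i) = c • volume := by
  have key : ∀ a b : ℝ, prob.bind (dP i) (Set.Ioc a b) = c * volume (Set.Ioc a b) := by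
    intro a b
    rw [Measure.bind_apply measurableSet_Ioc (hdP i).aemeasurable]
    -- On the sure event the compensator identity compares plain expectations; Tonelli then brings
    -- in the constant mean.
    have h := hlam.compensator i a b Set.univ MeasurableSet.univ
    simp only [Measure.restrict_univ] at h
    rw [h, lintegral_lintegral_swap]
    · simp [hmean]
    · exact ((hlam.measurable i).comp measurable_swap).aemeasurable
  refine Measure.ext_of_Ioc' _ _ (fun a b _ => ?_) fun a b _ => ?_
  · rw [key, Real.volume_Ioc]
    exact ENNReal.mul_ne_top hc ENNReal.ofReal_ne_top
  · rw [key, Measure.smul_apply, smul_eq_mul]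

/-- The balance equation `Λ = M + (∫ Φ) Λ` of the mean intensity. -/
lemma IsHawkesProcess.mean_balance [MeasurableSpace Ω] [Fintype ι] {prob : Measure Ω} {M : ι → ℝ}
    {Φ : ℝ → Matrix ι ι ℝ} (hΦ : ∀ i j, Measurable fun t => Φ t i j) {dP : ι → Ω → Measure ℝ}
    (hP : IsHawkesProcess prob M Φ dP) [IsProbabilityMeasure prob] {c : ι → ℝ≥0∞}
    (hc : ∀ i, c i ≠ ∞) (hmean : ∀ i t, ∫⁻ ω, hawkesIntensity M Φ dP i t ω ∂prob = c i) (i : ι) :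
    c i = ENNReal.ofReal (M i) + ∑ j, c j * ∫⁻ s, ENNReal.ofReal (Φ s i j) := by
  have hm := fun j => measurable_ofReal_comp_sub (hΦ i j) 0
  have hterm : ∀ j, Measurable fun ω => ∫⁻ s, ENNReal.ofReal (Φ (0 - s) i j) ∂(dP j ω) :=
    fun j => (Measure.measurable_lintegral (hm j)).comp (hP.counting.measurable j)
  rw [← hmean i 0]
  unfold hawkesIntensity
  rw [lintegral_add_left measurable_const, lintegral_finsetSum _ fun j _ => hterm j]
  congr 1
  · simp
  refine Finset.sum_congr rfl fun j _ => ?_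
  -- Campbell's formula: the mean of an integral against `dP j` is the integral against the mean
  -- measure, here `c j • volume`. The reflection `s ↦ 0 - s` preserves Lebesgue measure.
  rw [← Measure.lintegral_bind (hP.counting.measurable j).aemeasurable (hm j).aemeasurable,
    hP.intensity.bind_eq_smul_volume hP.counting.measurable (hc j) (hmean j),
    lintegral_smul_measure, smul_eq_mul,
    lintegral_sub_left_eq_self (fun s => ENNReal.ofReal (Φ s i j)) 0]

end MeanIntensity

/-! ### Laplace transforms of causal kernels. -/

section Laplace

variable {m n : Type*}

lemma lap_zero_apply (F : ℝ → Matrix m n ℝ) (i : m) (j : n) :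
    lap F 0 i j = ((∫ t, F t i j : ℝ) : ℂ) := by
  simpa [lap] using integral_ofReal (𝕜 := ℂ) (f := fun t => F t i j)

/-- On the closed lower half plane the Laplace transform of a causal nonnegative kernel is
dominated by its value at `0`. -/
lemma norm_lap_apply_le {F : ℝ → Matrix m n ℝ} {i : m} {j : n}
    (hF : IsKernelFunction fun t => F t i j) {z : ℂ} (hz : z.im ≤ 0) :
    ‖lap F z i j‖ ≤ ∫ t, F t i j := by
  refine norm_integral_le_of_norm_le hF.integrable (ae_of_all _ fun t => ?_)
  -- The exponential has modulus `exp (t * z.im)`, at most `1` for `t ≥ 0`; causality removes `t <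
  -- 0`.
  rw [norm_mul, Complex.norm_exp, Complex.norm_real, Real.norm_of_nonneg (hF.nonneg t)]
  rcases lt_or_ge t 0 with ht | ht
  · simp [hF.causal t ht]
  · refine mul_le_of_le_one_left (hF.nonneg t) (Real.exp_le_one_iff.2 ?_)
    simpa using mul_nonpos_of_nonpos_of_nonneg hz ht

/-- The Laplace transform at `0` turns the balance equation into a linear system. -/
lemma one_sub_lap_zero_mulVec [Fintype n] [DecidableEq n] {F : ℝ → Matrix n n ℝ}
    (hF : ∀ i j, IsKernelFunction fun t => F t i j) {M : n → ℝ} (hM : ∀ i, 0 ≤ M i)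
    {c : n → ℝ≥0∞} (hc : ∀ i, c i ≠ ∞)
    (h : ∀ i, c i = ENNReal.ofReal (M i) + ∑ j, c j * ∫⁻ s, ENNReal.ofReal (F s i j)) :
    (1 - lap F 0) *ᵥ (fun i => (((c i).toReal : ℝ) : ℂ)) = fun i => (M i : ℂ) := by
  ext i
  have hi : (c i).toReal = M i + ∑ j, (c j).toReal * ∫ s, F s i j := by
    have hint : ∀ j, ∫⁻ s, ENNReal.ofReal (F s i j) = ENNReal.ofReal (∫ s, F s i j) := fun j =>
      (ofReal_integral_eq_lintegral_ofReal (hF i j).integrable (ae_of_all _ (hF i j).nonneg)).symm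
    have hne : ∀ j ∈ Finset.univ, c j * ENNReal.ofReal (∫ s, F s i j) ≠ ∞ := fun j _ =>
      ENNReal.mul_ne_top (hc j) ENNReal.ofReal_ne_top
    have h := h i
    simp only [hint] at h
    rw [h, ENNReal.toReal_add ENNReal.ofReal_ne_top (ENNReal.sum_ne_top.2 hne),
      ENNReal.toReal_sum hne, ENNReal.toReal_ofReal (hM i)]
    simp_rw [ENNReal.toReal_mul, ENNReal.toReal_ofReal (integral_nonneg (hF i _).nonneg)]
  rw [Matrix.sub_mulVec, Matrix.one_mulVec, Pi.sub_apply, hi]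
  simp only [Matrix.mulVec, dotProduct, lap_zero_apply, Complex.ofReal_add, Complex.ofReal_sum,
    Complex.ofReal_mul, mul_comm, add_sub_cancel_right]

end Laplace

/-! ### Spectral criterion for invertibility and commuting block matrices. -/

section LinearAlgebra

variable {n : Type*} [Fintype n] [DecidableEq n]

lemma isUnit_of_mulVec_eq_zero {K : Type*} [Field K] {A : Matrix n n K}
    (h : ∀ v, A *ᵥ v = 0 → v = 0) : IsUnit A := by
  rw [Matrix.isUnit_iff_isUnit_det, isUnit_iff_ne_zero, ne_eq, ← Matrix.exists_mulVec_eq_zero_iff]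
  rintro ⟨v, hv, hv0⟩
  exact hv (h v hv0)

lemma eq_zero_of_mulVec_eq_zero {K : Type*} [Field K] {A : Matrix n n K} (hA : IsUnit A)
    {v : n → K} (h : A *ᵥ v = 0) : v = 0 :=
  Matrix.mulVec_injective_of_isUnit hA (by rw [h, Matrix.mulVec_zero])

open scoped Matrix.Norms.Operator in
/-- Some power of a complex matrix whose eigenvalues lie in the open unit disc has norm smaller
than one. -/
lemma exists_linftyOpNorm_pow_lt_one {B : Matrix n n ℂ} (hB : ∀ x ∈ spectrum ℂ B, ‖x‖ < 1) :
    ∃ k : ℕ, ‖B ^ k‖ < 1 := by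
  -- Over an empty index type the matrix ring is trivial, so even the zeroth power is zero.
  cases isEmpty_or_nonempty n
  · exact ⟨0, by rw [Subsingleton.elim (B ^ 0) 0, norm_zero]; exact one_pos⟩
  have hr : spectralRadius ℂ B < ((1 : ℝ≥0) : ℝ≥0∞) :=
    spectrum.spectralRadius_lt_of_forall_lt B fun z hz => by exact_mod_cast hB z hz
  -- Gelfand's formula: `‖B ^ k‖ ^ (1 / k)` tends to the spectral radius, hence is eventually below
  -- `1`.
  have hlim := spectrum.pow_nnnorm_pow_one_div_tendsto_nhds_spectralRadius B
  obtain ⟨k, hk, hk0⟩ :=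
    ((hlim.eventually_lt_const hr).and (Filter.eventually_gt_atTop 0)).exists
  refine ⟨k, ?_⟩
  by_contra! hge
  refine absurd hk (not_lt.2 ?_)
  rw [ENNReal.coe_one]
  exact ENNReal.one_le_rpow (by exact_mod_cast hge) (by positivity)

open scoped Matrix.Norms.Operator in
/-- A matrix dominated entrywise by a nonnegative matrix with eigenvalues in the open unit disc
does not have the eigenvalue `1`. -/
lemma isUnit_one_sub_of_norm_le {A : Matrix n n ℂ} {b : Matrix n n ℝ}
    (hAb : ∀ i j, ‖A i j‖ ≤ b i j)
    (hb : ∀ x ∈ spectrum ℂ (b.map (algebraMap ℝ ℂ)), ‖x‖ < 1) : IsUnit (1 - A) := by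
  refine isUnit_of_mulVec_eq_zero fun v hv => ?_
  rw [Matrix.sub_mulVec, Matrix.one_mulVec, sub_eq_zero] at hv
  have hb0 : ∀ i j, 0 ≤ b i j := fun i j => (norm_nonneg _).trans (hAb i j)
  set w : n → ℝ := fun i => ‖v i‖ with hw
  have hmono : ∀ x y : n → ℝ, x ≤ y → b *ᵥ x ≤ b *ᵥ y := fun x y hxy i =>
    Finset.sum_le_sum fun j _ => mul_le_mul_of_nonneg_left (hxy j) (hb0 i j)
  have hstep : w ≤ b *ᵥ w := fun i => by
    have : ‖v i‖ = ‖∑ j, A i j * v j‖ := by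
      conv_lhs => rw [hv]
      rfl
    rw [hw]
    simp only [this]
    refine (norm_sum_le _ _).trans (Finset.sum_le_sum fun j _ => ?_)
    rw [norm_mul]
    exact mul_le_mul_of_nonneg_right (hAb i j) (norm_nonneg _)
  -- Nonnegativity of `b` makes it monotone, so `w ≤ b w` can be iterated; no Perron eigenvector is
  -- needed.
  have hpow : ∀ k : ℕ, w ≤ (b ^ k) *ᵥ w := by
    intro k
    induction k with
    | zero => simp
    | succ k ih =>
      rw [pow_succ', ← Matrix.mulVec_mulVec]
      exact hstep.trans (hmono _ _ ih)
  obtain ⟨k, hk⟩ := exists_linftyOpNorm_pow_lt_one hb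
  have hle : ‖v‖ ≤ ‖(b.map (algebraMap ℝ ℂ)) ^ k‖ * ‖v‖ := by
    have h1 := Matrix.linfty_opNorm_mulVec ((b.map (algebraMap ℝ ℂ)) ^ k) (fun j => (w j : ℂ))
    have h2 : ‖(fun j => (w j : ℂ))‖ = ‖v‖ := by
      simp only [Pi.norm_def, hw]
      congr 2
      ext j
      simp
    rw [h2] at h1
    refine ((pi_norm_le_iff_of_nonneg (norm_nonneg _)).2 fun i => ?_).trans h1
    refine le_trans ?_ (norm_le_pi_norm _ i)
    have h3 : (((b.map (algebraMap ℝ ℂ)) ^ k) *ᵥ fun j => (w j : ℂ)) i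
        = (((b ^ k) *ᵥ w) i : ℝ) := by
      rw [← Matrix.map_pow]
      simp [Matrix.mulVec, dotProduct]
    rw [h3, Complex.norm_real]
    exact (hpow k i).trans (le_abs_self _)
  by_contra hv0
  exact absurd hle (not_le.2 (mul_lt_of_lt_one_left (norm_pos_iff.2 hv0) hk))

/-- For pairwise commuting blocks, `A D - B C` is invertible as soon as the block matrix is. -/
lemma isUnit_mul_sub_mul_of_isUnit_fromBlocks {K : Type*} [Field K] {A B C D : Matrix n n K}
    (hAB : Commute A B) (hAD : Commute A D) (hBC : Commute B C) (hCD : Commute C D)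
    (h : IsUnit (Matrix.fromBlocks A B C D)) : IsUnit (A * D - B * C) := by
  refine isUnit_of_mulVec_eq_zero fun w hw => ?_
  rw [Matrix.sub_mulVec] at hw
  have key : ∀ x y : n → K, A *ᵥ x + B *ᵥ y = 0 → C *ᵥ x + D *ᵥ y = 0 → x = 0 ∧ y = 0 := by
    intro x y h1 h2
    have h0 : Sum.elim x y = 0 := by
      apply eq_zero_of_mulVec_eq_zero h
      rw [Matrix.fromBlocks_mulVec]
      simp only [Sum.elim_comp_inl, Sum.elim_comp_inr, h1, h2]
      ext (i | i) <;> rfl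
    exact ⟨funext fun i => congrFun h0 (.inl i), funext fun i => congrFun h0 (.inr i)⟩
  -- For `w` in the kernel of `A D - B C`, the vectors `(D w, -C w)` and `(B w, -A w)` are
  -- annihilated by the block matrix, by commutation. Thus `D w = B w = 0`, which puts `(0, w)` in
  -- its kernel too.
  obtain ⟨hD, -⟩ := key (D *ᵥ w) (-(C *ᵥ w))
    (by simpa [Matrix.mulVec_neg, sub_eq_add_neg] using hw)
    (by simp [Matrix.mulVec_neg, hCD.eq])
  obtain ⟨hB, -⟩ := key (B *ᵥ w) (-(A *ᵥ w))
    (by simp [Matrix.mulVec_neg, hAB.eq])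
    (by
      rw [Matrix.mulVec_neg, Matrix.mulVec_mulVec, Matrix.mulVec_mulVec, ← hBC.eq, ← hAD.eq,
        ← sub_eq_add_neg, ← neg_sub, hw, neg_zero])
  exact (key 0 w (by simp [hB]) (by simp [hD])).2

end LinearAlgebra

/-! ### The symmetric 2 × 2 blocks and the 4 × 4 system. -/

lemma lap_block (s c : ℝ → ℝ) (z : ℂ) : ∃ a b : ℂ, lap (block s c) z = !![a, b; b, a] :=
  ⟨lap (block s c) z 0 0, lap (block s c) z 0 1, by
    ext i j; fin_cases i <;> fin_cases j <;> simp [lap, block]⟩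

/-- Each block is a linear combination of the identity and the coordinate swap. -/
lemma commute_lap_block (s c s' c' : ℝ → ℝ) (z : ℂ) :
    Commute (lap (block s c) z) (lap (block s' c') z) := by
  obtain ⟨a, b, h⟩ := lap_block s c z
  obtain ⟨a', b', h'⟩ := lap_block s' c' z
  rw [h, h', commute_iff_eq]
  ext i j
  fin_cases i <;> fin_cases j <;> simp [Matrix.mul_apply] <;> ring

namespace Kernels

variable {φ : Kernels}

lemma Admissible.isKernelFunction (hφ : φ.Admissible) (i j : Comp) :
    IsKernelFunction fun t => φ.Φ t i j := by
  obtain ⟨h1, h2, h3, h4, h5, h6, h7, h8⟩ := hφ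
  rcases i with i | i <;> rcases j with j | j <;> fin_cases i <;> fin_cases j <;> assumption

lemma one_sub_lap_Φ (φ : Kernels) (z : ℂ) : 1 - lap φ.Φ z =
    Matrix.fromBlocks (1 - lap φ.ΦT z) (-lap φ.ΦF z) (-lap φ.ΦI z) (1 - lap φ.ΦN z) := by
  have h : lap φ.Φ z =
      Matrix.fromBlocks (lap φ.ΦT z) (lap φ.ΦF z) (lap φ.ΦI z) (lap φ.ΦN z) := by
    ext (i | i) (j | j) <;> rfl
  rw [h, ← Matrix.fromBlocks_one, sub_eq_add_neg, Matrix.fromBlocks_neg, Matrix.fromBlocks_add]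
  simp [sub_eq_add_neg]

/-- Domination by the integrals of the kernels, the entries of `Φ̂₀`, carries (H) from `z = 0` to
the closed lower half plane. -/
lemma isUnit_one_sub_lap (hφ : φ.Admissible) (hH : φ.ConditionH) {z : ℂ} (hz : z.im ≤ 0) :
    IsUnit (1 - lap φ.Φ z) := by
  refine isUnit_one_sub_of_norm_le (b := Matrix.of fun i j => ∫ t, φ.Φ t i j)
    (fun i j => norm_lap_apply_le (hφ.isKernelFunction i j) hz) ?_
  have h : (Matrix.of fun i j => ∫ t, φ.Φ t i j).map (algebraMap ℝ ℂ) = lap φ.Φ 0 := by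
    ext i j
    exact (lap_zero_apply φ.Φ i j).symm
  rw [h]
  exact hH

lemma isUnit_schur {z : ℂ} (h : IsUnit (1 - lap φ.Φ z)) : IsUnit (φ.schur z) := by
  rw [one_sub_lap_Φ] at h
  have hc : ∀ s c s' c' : ℝ → ℝ, Commute (lap (block s c) z) (lap (block s' c') z) :=
    fun s c s' c' => commute_lap_block s c s' c' z
  have := isUnit_mul_sub_mul_of_isUnit_fromBlocks
    (((Commute.one_left _).sub_left (hc _ _ _ _)).neg_right)
    ((Commute.one_left _).sub_left ((Commute.one_right _).sub_right (hc _ _ _ _)))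
    ((hc _ _ _ _).neg_left.neg_right)
    (((Commute.one_right _).sub_right (hc _ _ _ _)).neg_left) h
  rwa [neg_mul_neg] at this

/-- The solution of the linear system for the mean intensity is invariant under the exchange of
the two components of each block. -/
lemma solution_symmetric {μ : ℝ} (hU : IsUnit (1 - lap φ.Φ 0)) {x : Comp → ℂ}
    (hx : (1 - lap φ.Φ 0) *ᵥ x = fun i => (exogenous μ i : ℂ)) :
    x (.inl 1) = x (.inl 0) ∧ x (.inr 1) = x (.inr 0) := by
  -- `σ` exchanges `-` and `+` in both pairs. Blocks and right-hand side are invariant under it, so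
  -- `x ∘ σ` solves the same system and injectivity gives `x ∘ σ = x`.
  let σ : Comp → Comp := Sum.map Fin.rev Fin.rev
  have hσ : (1 - lap φ.Φ 0) *ᵥ (x ∘ σ) = fun i => (exogenous μ i : ℂ) := by
    obtain ⟨a, b, hT⟩ := lap_block φ.Ts φ.Tc 0
    obtain ⟨a', b', hF⟩ := lap_block φ.Fs φ.Fc 0
    obtain ⟨a'', b'', hI⟩ := lap_block φ.Is φ.Ic 0
    obtain ⟨a''', b''', hN⟩ := lap_block φ.Ns φ.Nc 0
    rw [one_sub_lap_Φ, ΦT, ΦF, ΦI, ΦN, hT, hF, hI, hN] at hx ⊢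
    have h0 := congrFun hx (.inl 0)
    have h1 := congrFun hx (.inl 1)
    have h2 := congrFun hx (.inr 0)
    have h3 := congrFun hx (.inr 1)
    simp [Matrix.mulVec, dotProduct, Fin.sum_univ_two, exogenous] at h0 h1 h2 h3
    ext (i | i) <;> fin_cases i <;>
      simp [Matrix.mulVec, dotProduct, Fin.sum_univ_two, exogenous, σ]
    · linear_combination h1
    · linear_combination h0
    · linear_combination h3
    · linear_combination h2
  have h := Matrix.mulVec_injective_of_isUnit hU (hσ.trans hx.symm)
  exact ⟨congrFun h (.inl 0), congrFun h (.inr 0)⟩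

/-- The block form of the solution of the linear system for the mean intensity. -/
lemma schur_mulVec_solution {μ : ℝ} {x y : Fin 2 → ℂ}
    (hx : (1 - lap φ.Φ 0) *ᵥ Sum.elim x y = fun i => (exogenous μ i : ℂ)) :
    φ.schur 0 *ᵥ x = (μ : ℂ) • ((1 - lap φ.ΦN 0) *ᵥ ![1, 1]) ∧
      φ.schur 0 *ᵥ y = (μ : ℂ) • (lap φ.ΦI 0 *ᵥ ![1, 1]) := by
  rw [one_sub_lap_Φ, Matrix.fromBlocks_mulVec] at hx
  simp only [Sum.elim_comp_inl, Sum.elim_comp_inr] at hx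
  set T := lap φ.ΦT 0
  set F := lap φ.ΦF 0
  set I := lap φ.ΦI 0
  set N := lap φ.ΦN 0
  have h1 : (1 - T) *ᵥ x - F *ᵥ y = (μ : ℂ) • ![1, 1] := by
    ext i
    have := congrFun hx (.inl i)
    fin_cases i <;> simpa [exogenous, sub_eq_add_neg, Matrix.neg_mulVec] using this
  have h2 : (1 - N) *ᵥ y = I *ᵥ x := by
    ext i
    have := congrFun hx (.inr i)
    simp only [exogenous, Sum.elim_inr, Pi.add_apply, Matrix.neg_mulVec, Pi.neg_apply,
      Complex.ofReal_zero] at this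
    linear_combination this
  have hTN : Commute (1 - T) (1 - N) :=
    (Commute.one_left _).sub_left ((Commute.one_right _).sub_right (commute_lap_block _ _ _ _ _))
  have hFN : Commute (1 - N) F := (Commute.one_left _).sub_left (commute_lap_block _ _ _ _ _)
  have hTI : Commute (1 - T) I := (Commute.one_left _).sub_left (commute_lap_block _ _ _ _ _)
  have hFI : Commute F I := commute_lap_block _ _ _ _ _
  -- Elimination: apply `1 - N`, respectively `I`, to the first equation `h1`, and use `h2` and
  -- commutation to remove the other unknown.
  constructor
  · calc ((1 - T) * (1 - N) - F * I) *ᵥ x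
        = (1 - N) *ᵥ ((1 - T) *ᵥ x) - F *ᵥ (I *ᵥ x) := by
          rw [Matrix.sub_mulVec, hTN.eq, Matrix.mulVec_mulVec, Matrix.mulVec_mulVec]
      _ = (1 - N) *ᵥ ((1 - T) *ᵥ x - F *ᵥ y) := by
          rw [← h2, Matrix.mulVec_sub, Matrix.mulVec_mulVec y F, ← hFN.eq, Matrix.mulVec_mulVec y]
      _ = _ := by rw [h1, Matrix.mulVec_smul]
  · calc ((1 - T) * (1 - N) - F * I) *ᵥ y
        = (1 - T) *ᵥ ((1 - N) *ᵥ y) - (F * I) *ᵥ y := by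
          rw [Matrix.sub_mulVec, Matrix.mulVec_mulVec]
      _ = I *ᵥ ((1 - T) *ᵥ x - F *ᵥ y) := by
          rw [h2, Matrix.mulVec_mulVec, hTI.eq, hFI.eq, Matrix.mulVec_sub, Matrix.mulVec_mulVec,
            Matrix.mulVec_mulVec]
      _ = _ := by rw [h1, Matrix.mulVec_smul]

end Kernels

end HawkesPrice

end

/-! ### Assembly of the proposition. -/

open HawkesPrice in
theorem proposition2 {Ω : Type*} [MeasurableSpace Ω] (prob : Measure Ω) [IsProbabilityMeasure prob]
    (φ : Kernels) (hφ : φ.Admissible) (hH : φ.ConditionH) (μ : ℝ) (hμ : 0 ≤ μ)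
    (dP : Comp → Ω → Measure ℝ)
    (hP : IsHawkesProcess prob (exogenous μ) φ.Φ dP)
    (hstat : HasStationaryIncrements prob dP)
    (hfin : ∀ i, ∫⁻ ω, hawkesIntensity (exogenous μ) φ.Φ dP i 0 ω ∂prob ≠ ∞) :
    -- the inverse matrices in the formulas exist
    IsUnit (1 - lap φ.Φ 0) ∧
    (∀ z : ℂ, z.im ≤ 0 → IsUnit (φ.schur z)) ∧
    ∃ ΛT ΛN : ℝ≥0,
      -- the mean intensity, at any time, is the vector `(ΛT, ΛT, ΛN, ΛN)`
      (∀ t i, ∫⁻ ω, hawkesIntensity (exogenous μ) φ.Φ dP (Sum.inl i) t ω ∂prob = ΛT) ∧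
      (∀ t i, ∫⁻ ω, hawkesIntensity (exogenous μ) φ.Φ dP (Sum.inr i) t ω ∂prob = ΛN) ∧
      -- and it is given by the formulas
      Sum.elim (fun _ : Fin 2 => ((ΛT : ℝ) : ℂ)) (fun _ : Fin 2 => ((ΛN : ℝ) : ℂ)) =
        (1 - lap φ.Φ 0)⁻¹ *ᵥ (fun i => (exogenous μ i : ℂ)) ∧
      ![((ΛT : ℝ) : ℂ), ((ΛT : ℝ) : ℂ)] =
        (μ : ℂ) • (((1 + φ.Dhat 0) * (1 - lap φ.ΦN 0)) *ᵥ ![1, 1]) ∧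
      ![((ΛN : ℝ) : ℂ), ((ΛN : ℝ) : ℂ)] =
        (μ : ℂ) • (((1 + φ.Dhat 0) * lap φ.ΦI 0) *ᵥ ![1, 1]) := by
  have hM : ∀ i, 0 ≤ exogenous μ i := by
    rintro (i | i)
    exacts [hμ, le_rfl]
  have hU : IsUnit (1 - lap φ.Φ 0) := Kernels.isUnit_one_sub_lap hφ hH le_rfl
  have hS : ∀ z : ℂ, z.im ≤ 0 → IsUnit (φ.schur z) := fun z hz =>
    Kernels.isUnit_schur (Kernels.isUnit_one_sub_lap hφ hH hz)
  refine ⟨hU, hS, ?_⟩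
  have hK := hφ.isKernelFunction
  have hmeas : ∀ i j, Measurable fun t => φ.Φ t i j := fun i j => (hK i j).measurable
  set c : Comp → ℝ≥0∞ := fun i => ∫⁻ ω, hawkesIntensity (exogenous μ) φ.Φ dP i 0 ω ∂prob
  have hmean : ∀ i t, ∫⁻ ω, hawkesIntensity (exogenous μ) φ.Φ dP i t ω ∂prob = c i :=
    lintegral_hawkesIntensity_eq_of_stationary _ hmeas hstat
  have hsol := one_sub_lap_zero_mulVec hK hM hfin (hP.mean_balance hmeas hfin hmean)
  obtain ⟨h1, h2⟩ := Kernels.solution_symmetric hU hsol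
  have hcT : ∀ i : Fin 2, (c (.inl i)).toNNReal = (c (.inl 0)).toNNReal := by
    intro i
    fin_cases i
    · rfl
    · exact NNReal.coe_injective (Complex.ofReal_injective h1)
  have hcN : ∀ i : Fin 2, (c (.inr i)).toNNReal = (c (.inr 0)).toNNReal := by
    intro i
    fin_cases i
    · rfl
    · exact NNReal.coe_injective (Complex.ofReal_injective h2)
  set ΛT := (c (.inl 0)).toNNReal
  set ΛN := (c (.inr 0)).toNNReal
  have hvec : (fun i => (((c i).toReal : ℝ) : ℂ)) =
      Sum.elim ![((ΛT : ℝ) : ℂ), ((ΛT : ℝ) : ℂ)] ![((ΛN : ℝ) : ℂ), ((ΛN : ℝ) : ℂ)] := by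
    ext (i | i)
    · simp only [ENNReal.toReal, hcT i]
      fin_cases i <;> rfl
    · simp only [ENNReal.toReal, hcN i]
      fin_cases i <;> rfl
  rw [hvec] at hsol
  obtain ⟨hT, hN⟩ := Kernels.schur_mulVec_solution hsol
  -- `1 + D̂₀` is by definition the inverse of `schur 0`, so both explicit formulas follow by
  -- inverting the eliminated equations.
  have hinv : ∀ x w : Fin 2 → ℂ, ∀ A : Matrix (Fin 2) (Fin 2) ℂ,
      φ.schur 0 *ᵥ x = (μ : ℂ) • (A *ᵥ w) → x = (μ : ℂ) • (((1 + φ.Dhat 0) * A) *ᵥ w) := by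
    intro x w A h
    have hdet := (Matrix.isUnit_iff_isUnit_det _).1 (hS 0 le_rfl)
    rw [Kernels.Dhat, add_sub_cancel, ← Matrix.mulVec_mulVec, ← Matrix.mulVec_smul, ← h,
      Matrix.mulVec_mulVec, Matrix.nonsing_inv_mul _ hdet, Matrix.one_mulVec]
  refine ⟨ΛT, ΛN, fun t i => ?_, fun t i => ?_, ?_, hinv _ _ _ hT, hinv _ _ _ hN⟩
  · rw [hmean, ← hcT i, ENNReal.coe_toNNReal (hfin _)]
  · rw [hmean, ← hcN i, ENNReal.coe_toNNReal (hfin _)]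
  · have hdet := (Matrix.isUnit_iff_isUnit_det _).1 hU
    rw [← hsol, Matrix.mulVec_mulVec, Matrix.nonsing_inv_mul _ hdet, Matrix.one_mulVec]
    congr 1 <;> ext i <;> fin_cases i <;> rfl
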